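/- **Definitions.** All graphs are finite and simple, with edge weights in $[0,\infty)$. For a weighted graph $G=(V,E,w)$, $d_G(x,y)$ is the shortest-path distance ($\infty$ if $x,y$ are not connected in $G$). An *oblivious $\nu$-reliable $t$-spanner* of $G$ is a (discrete) probability distribution $\mathcal D$ over weighted graphs $H$ on the vertex set $V$ (not necessarily subgraphs of $G$) such that every $H\in\mathrm{supp}(\mathcal D)$ satisfies $d_G(x,y)\le d_H(x,y)$ for all $x,y\in V$, and for every $B\subseteq V$ and every $H\in\mathrm{supp}(\mathcal D)$ there is a set $B^+=B^+(B,H)\supseteq B$ with $$d_{H[V\setminus B]}(x,y)\le t\cdot d_G(x,y)\quad\text{for all }x,y\in V\setminus B^+,\qquad \mathbb E_{H\sim\mathcal D}\big[|B^+|\big]\le(1+\nu)|B| .$$ It *has $m$ edges* if every $H\in\mathrm{supp}(\mathcal D)$ has at most $m$ edges. **Theorem.** There are absolute constants $C,c>0$ such that the following hold for every $\nu\in(0,1)$. 1. For every integer $k\ge 0$, every $n$-vertex weighted graph of treewidth at most $k$ admits an oblivious $\nu$-reliable $2$-spanner with $C\, n\,\nu^{-1}k^2\log^3 n$ edges. 2.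 In particular, every $n$-vertex weighted tree admits an oblivious $\nu$-reliable $2$-spanner with $C\,n\,\nu^{-1}\log^3 n$ edges. 3. The stretch $2$ is optimal: for every $n\ge 2$ there is an $n$-vertex unweighted tree (all edge weights equal to $1$) such that, for every $t<2$, every oblivious $\nu$-reliable $t$-spanner of it that has $m$ edges satisfies $m\ge c\,n^2$. -/

import Mathlib

open scoped NNReal ENNReal

/-- A graph on the vertex set `V` with non-negative edge weights. Only the weights of edges of
`graph` matter; the value of `weight` elsewhere is never used. -/
structure WeightedGraph (V : Type*) where
  graph : SimpleGraph V
  weight : Sym2 V → ℝ≥0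

namespace WeightedGraph

variable {V : Type*}

/-- The total weight of the edges along a walk (with multiplicity). -/
def walkWeight (G : WeightedGraph V) {x y : V} (p : G.graph.Walk x y) : ℝ≥0 :=
  (p.edges.map G.weight).sum

/-- The shortest path distance of a weighted graph; it is `∞` between vertices that lie in
different connected components. -/
noncomputable def dist (G : WeightedGraph V) (x y : V) : ℝ≥0∞ :=
  ⨅ p : G.graph.Walk x y, (G.walkWeight p : ℝ≥0∞)

/-- Failure of the vertices in `B`: all edges that meet `B` are removed. The vertices of `B` are
kept as isolated vertices, so that between vertices outside `B` the walks, and hence the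
distances, are those of the induced subgraph on the complement of `B`. -/
def removeVerts (G : WeightedGraph V) (B : Finset V) : WeightedGraph V where
  graph :=
    { Adj := fun x y => G.graph.Adj x y ∧ x ∉ B ∧ y ∉ B
      symm := ⟨fun _ _ h => ⟨h.1.symm, h.2.2, h.2.1⟩⟩
      loopless := ⟨fun _ h => h.1.ne rfl⟩ }
  weight := G.weight

/-- The number of edges (used for finite vertex sets). -/
noncomputable def numEdges (G : WeightedGraph V) : ℕ := G.graph.edgeSet.ncard

/-- `G` dominates the distance function `d`. -/
def Dominates (G : WeightedGraph V) (d : V → V → ℝ≥0∞) : Prop :=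
  ∀ x y, d x y ≤ G.dist x y

/-- A graph is unweighted if every edge has weight one. -/
def IsUnweighted (G : WeightedGraph V) : Prop :=
  ∀ e ∈ G.graph.edgeSet, G.weight e = 1

end WeightedGraph

/-- `D` is an oblivious `ν`-reliable `t`-spanner of the (finite) space `V` with distance `d`:
a distribution over dominating weighted graphs `H` on `V` such that, for every attack set `B`,
every `H` in the support of `D` has a faulty extension `Bplus H ⊇ B` outside of which the graph
that survives the attack has stretch at most `t`, and the expected size of the faulty extension
is at most `(1 + ν) |B|`. -/
def IsObliviousReliableSpanner {V : Type*} (d : V → V → ℝ≥0∞) (ν t : ℝ≥0)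
    (D : PMF (WeightedGraph V)) : Prop :=
  (∀ H ∈ D.support, H.Dominates d) ∧
  ∀ B : Finset V, ∃ Bplus : WeightedGraph V → Finset V,
    (∀ H ∈ D.support, B ⊆ Bplus H ∧
      ∀ x y, x ∉ Bplus H → y ∉ Bplus H → (H.removeVerts B).dist x y ≤ t * d x y) ∧
    ∑' H, D H * ((Bplus H).card : ℝ≥0∞) ≤ (1 + ν) * (B.card : ℝ≥0∞)

/-- The random graph `D` has `m` edges in the worst case: every graph in its support has at
most `m` edges. -/
def HasAtMostEdges {V : Type*} (D : PMF (WeightedGraph V)) (m : ℝ) : Prop :=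
  ∀ H ∈ D.support, (H.numEdges : ℝ) ≤ m

/-- A tree decomposition of `G`, indexed by a finite tree. -/
structure TreeDecomposition {V : Type*} (G : SimpleGraph V) where
  numNodes : ℕ
  tree : SimpleGraph (Fin numNodes)
  isTree : tree.IsTree
  bag : Fin numNodes → Finset V
  /-- Both endpoints of every edge lie in a common bag. -/
  edge_mem : ∀ x y, G.Adj x y → ∃ i, x ∈ bag i ∧ y ∈ bag i
  /-- The nodes whose bag contains a given vertex form a connected (in particular non-empty)
  subtree. -/
  connected : ∀ x, (tree.induce {i | x ∈ bag i}).Connected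

/-- `G` has treewidth at most `k`: it has a tree decomposition of width at most `k`, that is,
with all bags of size at most `k + 1`. -/
def HasTreewidthAtMost {V : Type*} (G : SimpleGraph V) (k : ℕ) : Prop :=
  ∃ T : TreeDecomposition G, ∀ i, (T.bag i).card ≤ k + 1

/-!
The upper bounds rest on a decomposition into clusters that are ordered by the distance from a
centre. A tree, and more generally a graph of treewidth at most `k`, has balanced separators of
size `1`, respectively `k + 1`: they sit at weighted medians of the (decomposition) tree
(`hasBalancedSeparators_of_tree`). Splitting recursively along them yields a family of pairs of a
cluster and a centre such that every vertex lies in `O(k log n)` clusters, and any two connected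
vertices lie in a common cluster whose centre is on a shortest connection between them
(`HasBalancedSeparators.exists_clusters`, `exists_cluster_dist_add_dist_le`).

Each cluster is ranked by the distance from its centre in `G`. The element of rank `j` is sampled
with probability `min 1 (s / (j + 1))`, independently, and sampled elements are joined to all
elements of higher rank. If a surviving `x` is preceded by some sampled survivor, then `x` and any
later `y` of the cluster are joined by a path of at most two edges and of length at most
`2 d(x, y)` (`dist_sampledSpanner_le_two_mul`). The other survivors are declared faulty; a potential
argument shows that in each cluster their expected number is at most `1 / (s - 1)` times the number
of attacked elements (`sum_prod_sampleProb_le`). The number of edges is small in expectation, and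
conditioning on its being at most twice its mean makes the bound hold for every graph of the
support, while expectations at most double (`exists_pmf_le_two_mul_mean`). The choice
`s = O(k log n / ν)` then gives the theorem.

For the optimality of the stretch, take a star and attack its centre. With expected loss less than
two, some graph of the support has no faulty vertex but the centre, and there all leaves must be
pairwise adjacent, since a detour over a third leaf costs `4`
(`adj_of_dist_removeVerts_lt_four`, `IsObliviousReliableSpanner.exists_forall_ne`).
-/

/-! ### Distances in weighted graphs -/

namespace WeightedGraph

variable {V : Type*}

theorem dist_le_walkWeight (G : WeightedGraph V) {x y : V} (p : G.graph.Walk x y) :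
    G.dist x y ≤ G.walkWeight p :=
  iInf_le _ p

@[simp]
theorem dist_self (G : WeightedGraph V) (x : V) : G.dist x x = 0 := by
  have h := G.dist_le_walkWeight (SimpleGraph.Walk.nil : G.graph.Walk x x)
  simpa [walkWeight] using h

theorem walkWeight_append (G : WeightedGraph V) {x y z : V} (p : G.graph.Walk x y)
    (q : G.graph.Walk y z) : G.walkWeight (p.append q) = G.walkWeight p + G.walkWeight q := by
  simp [walkWeight, SimpleGraph.Walk.edges_append]

theorem walkWeight_cons (G : WeightedGraph V) {x y z : V} (h : G.graph.Adj x y)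
    (q : G.graph.Walk y z) :
    G.walkWeight (SimpleGraph.Walk.cons h q) = G.weight s(x, y) + G.walkWeight q := by
  simp [walkWeight]

theorem dist_triangle (G : WeightedGraph V) (x y z : V) :
    G.dist x z ≤ G.dist x y + G.dist y z := by
  unfold dist
  rw [ENNReal.iInf_add]
  refine le_iInf fun p => ?_
  rw [ENNReal.add_iInf]
  refine le_iInf fun q => ?_
  refine (iInf_le _ (p.append q)).trans ?_
  rw [walkWeight_append, ENNReal.coe_add]

theorem dist_comm (G : WeightedGraph V) (x y : V) : G.dist x y = G.dist y x := by
  have key : ∀ x y, G.dist x y ≤ G.dist y x := fun x y => le_iInf fun p => by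
    refine (G.dist_le_walkWeight p.reverse).trans ?_
    simp [walkWeight]
  exact le_antisymm (key x y) (key y x)

theorem dist_le_weight (G : WeightedGraph V) {x y : V} (h : G.graph.Adj x y) :
    G.dist x y ≤ G.weight s(x, y) := by
  have := G.dist_le_walkWeight (SimpleGraph.Walk.cons h SimpleGraph.Walk.nil)
  simpa [walkWeight] using this

/-- A walk is at least as long as the detour through any of its vertices. -/
theorem dist_add_dist_le_walkWeight (G : WeightedGraph V) {x y v : V} (p : G.graph.Walk x y)
    (hv : v ∈ p.support) : G.dist x v + G.dist v y ≤ G.walkWeight p := by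
  classical
  rw [← p.take_spec hv, walkWeight_append, ENNReal.coe_add]
  exact add_le_add (G.dist_le_walkWeight _) (G.dist_le_walkWeight _)

/-- By the triangle inequality, domination only has to be checked on the edges. -/
theorem dominates_of_forall_adj (G H : WeightedGraph V)
    (h : ∀ x y, H.graph.Adj x y → G.dist x y ≤ H.weight s(x, y)) : H.Dominates G.dist := by
  intro x y
  refine le_iInf fun p => ?_
  induction p with
  | nil => simp
  | cons hadj q ih =>
    rw [walkWeight_cons, ENNReal.coe_add]
    exact (G.dist_triangle _ _ _).trans (add_le_add (h _ _ hadj) ih)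

theorem nonempty_walk_of_dist_ne_top (G : WeightedGraph V) {x y : V} (h : G.dist x y ≠ ∞) :
    Nonempty (G.graph.Walk x y) := by
  by_contra hne
  rw [not_nonempty_iff] at hne
  exact h (by simp [dist])

/-- The weighted graph on `V` without edges; its weight function is irrelevant. -/
def edgeless (V : Type*) : WeightedGraph V := ⟨⊥, 0⟩

end WeightedGraph

open WeightedGraph

/-- A graph without edges is a reliable spanner of itself: distinct vertices have distance `∞`. -/
theorem exists_spanner_of_graph_eq_bot {V : Type*} (G : WeightedGraph V)
    (hG : G.graph = ⊥) (ν t : ℝ≥0) (ht : t ≠ 0) :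
    ∃ D : PMF (WeightedGraph V), IsObliviousReliableSpanner G.dist ν t D ∧ HasAtMostEdges D 0 := by
  refine ⟨PMF.pure (edgeless V), ⟨?_, fun B => ⟨fun _ => B, ?_, ?_⟩⟩, ?_⟩
  · intro H hH
    rw [PMF.support_pure, Set.mem_singleton_iff] at hH
    subst hH
    exact dominates_of_forall_adj _ _ fun x y h => absurd h (by simp [edgeless])
  · refine fun H _ => ⟨subset_rfl, fun x y _ _ => ?_⟩
    rcases eq_or_ne x y with rfl | hxy
    · simp
    · have htop : G.dist x y = ∞ := by
        by_contra hne
        obtain ⟨p⟩ := G.nonempty_walk_of_dist_ne_top hne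
        cases p with
        | nil => exact hxy rfl
        | cons h _ => rw [hG] at h; exact h
      rw [htop, ENNReal.mul_top (by exact_mod_cast ht)]
      exact le_top
  · rw [ENNReal.tsum_mul_right, PMF.tsum_coe, one_mul]
    exact le_mul_of_one_le_left' le_self_add
  · intro H hH
    rw [PMF.support_pure, Set.mem_singleton_iff] at hH
    subst hH
    simp [numEdges, edgeless]

/-! ### Balanced separators -/

/-- Removing the edge between adjacent nodes `c` and `c'` splits a tree into the nodes closer to
`c'` and the nodes closer to `c`; no other edge crosses. -/
theorem SimpleGraph.IsTree.dist_lt_dist_of_adj {N : Type*} {T : SimpleGraph N} (hT : T.IsTree)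
    {c c' i j : N} (hcc : T.Adj c c') (hij : T.Adj i j) (hi : i ≠ c) (hj : j ≠ c)
    (h : T.dist c' i < T.dist c i) : T.dist c' j < T.dist c j := by
  classical
  by_contra! hlt
  obtain ⟨p, hp⟩ := hT.1.exists_walk_length_eq_dist c' i
  obtain ⟨q, hq⟩ := hT.1.exists_walk_length_eq_dist j c
  have hbridge := SimpleGraph.isBridge_iff_forall_walk_mem_edges.1
    (SimpleGraph.isAcyclic_iff_forall_adj_isBridge.1 hT.2 hcc.symm)
  have hcp : c ∉ p.support := fun hc => by
    have h1 := SimpleGraph.dist_le (p.dropUntil c hc)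
    have h2 := p.length_dropUntil_le_length hc
    omega
  have hcq : c' ∉ q.support := fun hc => by
    have h1 := SimpleGraph.dist_le (q.takeUntil c' hc)
    have h2 := congrArg SimpleGraph.Walk.length (q.take_spec hc)
    rw [SimpleGraph.Walk.length_append] at h2
    have h3 : (q.dropUntil c' hc).length ≠ 0 := fun h0 =>
      hcc.ne (SimpleGraph.Walk.eq_of_length_eq_zero h0).symm
    rw [SimpleGraph.dist_comm (u := c'), SimpleGraph.dist_comm (u := c)] at hlt
    omega
  have hmem := hbridge (p.append (SimpleGraph.Walk.cons hij q))
  rw [SimpleGraph.Walk.edges_append, SimpleGraph.Walk.edges_cons, List.mem_append,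
    List.mem_cons] at hmem
  rcases hmem with hm | hm | hm
  · exact hcp (p.snd_mem_support_of_mem_edges hm)
  · rw [Sym2.eq_iff] at hm
    rcases hm with ⟨_, h2⟩ | ⟨_, h2⟩
    · exact hj h2.symm
    · exact hi h2.symm
  · exact hcq (q.fst_mem_support_of_mem_edges hm)

/-- The weighted median of a tree is a centroid: towards each of its neighbours lies at most half
of the weight. -/
theorem SimpleGraph.Connected.exists_median {N V : Type*} [Finite N] {T : SimpleGraph N}
    (hT : T.Connected) (h : V → N) (K : Finset V) :
    ∃ c, ∀ c', T.Adj c c' →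
      2 * (K.filter fun x => T.dist c' (h x) < T.dist c (h x)).card ≤ K.card := by
  have := hT.nonempty
  obtain ⟨c, hc⟩ := Finite.exists_min fun c => ∑ x ∈ K, T.dist c (h x)
  refine ⟨c, fun c' hcc => ?_⟩
  have hle : ∑ x ∈ K, (T.dist c' (h x) + 2 * if T.dist c' (h x) < T.dist c (h x) then 1 else 0) ≤
      ∑ x ∈ K, (T.dist c (h x) + 1) := by
    refine Finset.sum_le_sum fun x _ => ?_
    have h1 := hT.dist_triangle (u := c') (v := c) (w := h x)
    rw [SimpleGraph.dist_eq_one_iff_adj.2 hcc.symm] at h1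
    split_ifs <;> omega
  have hmin := hc c'
  rw [Finset.sum_add_distrib, Finset.sum_add_distrib, ← Finset.mul_sum,
    ← Finset.card_filter] at hle
  simp only [Finset.sum_const, smul_eq_mul, mul_one] at hle
  omega

namespace WeightedGraph

variable {V : Type*}

open Classical in
/-- Every vertex set `K` has a separator of size at most `q`: once it is removed from `G`, each
component contains at most half of `K`. -/
def HasBalancedSeparators (G : WeightedGraph V) (q : ℕ) : Prop :=
  ∀ K : Finset V, ∃ S : Finset V, S.card ≤ q ∧ ∀ x ∉ S,
    2 * (K.filter fun y => (G.removeVerts S).graph.Reachable x y).card ≤ K.card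

/-- If `h` places the vertices of `G` on the nodes of a tree `T` so that `S c` separates the
parts of `G` placed in different components of `T - c`, then `G` has balanced separators, namely
the sets `S c` at weighted medians `c` of `T`. -/
theorem hasBalancedSeparators_of_tree (G : WeightedGraph V) {q : ℕ} {N : Type*} [Finite N]
    {T : SimpleGraph N} (hT : T.IsTree) (h : V → N) (S : N → Finset V)
    (hcard : ∀ c, (S c).card ≤ q) (hne : ∀ c, ∀ x ∉ S c, h x ≠ c)
    (hadj : ∀ c x y, G.graph.Adj x y → x ∉ S c → y ∉ S c → ∀ P : N → Prop,
      (∀ i j, T.Adj i j → i ≠ c → j ≠ c → P i → P j) → P (h x) → P (h y)) :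
    G.HasBalancedSeparators q := by
  classical
  intro K
  obtain ⟨c, hc⟩ := hT.1.exists_median h K
  refine ⟨S c, hcard c, fun x hx => ?_⟩
  -- the neighbour of `c` on the way to `h x`
  obtain ⟨c', hcc, hlt⟩ : ∃ c', T.Adj c c' ∧ T.dist c' (h x) < T.dist c (h x) := by
    obtain ⟨p, hp⟩ := hT.1.exists_walk_length_eq_dist c (h x)
    have hxc := hne c x hx
    cases p with
    | nil => exact absurd rfl hxc
    | cons hadj' p =>
      refine ⟨_, hadj', ?_⟩
      have := SimpleGraph.dist_le p
      rw [SimpleGraph.Walk.length_cons] at hp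
      omega
  have hwalk : ∀ (a b : V) (_ : (G.removeVerts (S c)).graph.Walk a b),
      T.dist c' (h a) < T.dist c (h a) → T.dist c' (h b) < T.dist c (h b) := by
    intro a b p
    induction p with
    | nil => exact id
    | cons hab _ ih =>
      exact fun ha => ih (hadj c _ _ hab.1 hab.2.1 hab.2.2 (fun i => T.dist c' i < T.dist c i)
        (fun i j hij hi hj => hT.dist_lt_dist_of_adj hcc hij hi hj) ha)
  refine le_trans (Nat.mul_le_mul_left 2 (Finset.card_le_card fun y hy => ?_)) (hc c' hcc)
  rw [Finset.mem_filter] at hy ⊢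
  obtain ⟨hyK, ⟨p⟩⟩ := hy
  exact ⟨hyK, hwalk x y p hlt⟩

theorem hasBalancedSeparators_of_isTree [Finite V] (G : WeightedGraph V)
    (hG : G.graph.IsTree) : G.HasBalancedSeparators 1 :=
  G.hasBalancedSeparators_of_tree hG id (fun c => {c}) (by simp) (by simp)
    fun c x y hxy hx hy P hP hPx => hP x y hxy (by simpa using hx) (by simpa using hy) hPx

theorem hasBalancedSeparators_of_hasTreewidthAtMost (G : WeightedGraph V) {k : ℕ}
    (hG : HasTreewidthAtMost G.graph k) : G.HasBalancedSeparators (k + 1) := by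
  obtain ⟨T, hT⟩ := hG
  have hhome : ∀ x, ∃ i, x ∈ T.bag i := fun x => by
    obtain ⟨i⟩ := (T.connected x).nonempty
    exact ⟨i.1, i.2⟩
  choose h hh using hhome
  have hmove : ∀ c x, x ∉ T.bag c → ∀ P : Fin T.numNodes → Prop,
      (∀ i j, T.tree.Adj i j → i ≠ c → j ≠ c → P i → P j) →
      ∀ i j, x ∈ T.bag i → x ∈ T.bag j → P i → P j := by
    intro c x hx P hP i j hi hj hPi
    obtain ⟨p⟩ := (T.connected x).preconnected ⟨i, hi⟩ ⟨j, hj⟩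
    have key : ∀ (a b : {i | x ∈ T.bag i}) (_ : (T.tree.induce {i | x ∈ T.bag i}).Walk a b),
        P a → P b := by
      intro a b p
      induction p with
      | nil => exact id
      | @cons a b _ hab _ ih =>
        exact fun ha => ih (hP a b hab (fun hac => hx (hac ▸ a.2)) (fun hbc => hx (hbc ▸ b.2)) ha)
    exact key _ _ p hPi
  refine G.hasBalancedSeparators_of_tree T.isTree h T.bag hT (fun c x hx hc => hx (hc ▸ hh x)) ?_
  intro c x y hxy hx hy P hP hPx
  obtain ⟨j, hjx, hjy⟩ := T.edge_mem x y hxy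
  exact hmove c y hy P hP j _ hjy (hh y) (hmove c x hx P hP _ j (hh x) hjx hPx)

/-! ### Centred clusters -/

/-- The recursive decomposition along balanced separators, as a family of pairs of a cluster and a
centre: whenever a walk stays within `K`, one of its vertices is the centre of a cluster that
contains both of its ends, namely a vertex of the first separator that the walk meets. -/
theorem HasBalancedSeparators.exists_clusters [DecidableEq V] {G : WeightedGraph V} {q : ℕ}
    (hG : G.HasBalancedSeparators q) (m : ℕ) (K : Finset V) (hK : K.card < 2 ^ m) :
    ∃ F : Finset (Finset V × V), (∀ p ∈ F, p.1 ⊆ K) ∧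
      (∀ x, (F.filter fun p => x ∈ p.1).card ≤ q * m) ∧
      ∀ (x y : V) (w : G.graph.Walk x y), (∀ z ∈ w.support, z ∈ K) →
        ∃ p ∈ F, x ∈ p.1 ∧ y ∈ p.1 ∧ p.2 ∈ w.support := by
  classical
  induction m generalizing K with
  | zero =>
    refine ⟨∅, by simp, by simp, fun x y w hw => ?_⟩
    rw [pow_zero, Nat.lt_one_iff, Finset.card_eq_zero] at hK
    subst hK
    exact absurd (hw x w.start_mem_support) (Finset.notMem_empty x)
  | succ m ih =>
    choose! F hF₁ hF₂ hF₃ using ih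
    obtain ⟨S, hSq, hS⟩ := hG K
    let D : V → Finset V := fun x => K.filter fun y => (G.removeVerts S).graph.Reachable x y
    have hDcard : ∀ x ∉ S, (D x).card < 2 ^ m := fun x hx => by
      have : 2 * (D x).card ≤ K.card := hS x hx
      rw [pow_succ] at hK
      omega
    have hDeq : ∀ x y, y ∈ D x → D y = D x := fun x y hy => by
      have hxy := (Finset.mem_filter.1 hy).2
      exact Finset.filter_congr fun z _ => ⟨hxy.trans, hxy.symm.trans⟩
    have hmemD : ∀ x ∈ K, x ∈ D x := fun x hx => Finset.mem_filter.2 ⟨hx, .refl _⟩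
    refine ⟨S.image (fun v => (K, v)) ∪ (K \ S).biUnion fun x => F (D x), ?_, fun x => ?_,
      fun x y w hw => ?_⟩
    · intro p hp
      rw [Finset.mem_union, Finset.mem_image, Finset.mem_biUnion] at hp
      rcases hp with ⟨v, _, rfl⟩ | ⟨x, hx, hp⟩
      · exact subset_rfl
      · exact (hF₁ _ (hDcard x (Finset.mem_sdiff.1 hx).2) p hp).trans (Finset.filter_subset _ _)
    · have hsub : ((S.image (fun v => (K, v)) ∪ (K \ S).biUnion fun x => F (D x)).filter
          fun p => x ∈ p.1) ⊆ S.image (fun v => (K, v)) ∪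
            if x ∈ S then ∅ else (F (D x)).filter fun p => x ∈ p.1 := by
        intro p hp
        rw [Finset.mem_filter, Finset.mem_union, Finset.mem_biUnion] at hp
        rw [Finset.mem_union]
        obtain ⟨hp | ⟨u, hu, hp⟩, hxp⟩ := hp
        · exact Or.inl hp
        · right
          have huS := (Finset.mem_sdiff.1 hu).2
          have hxD : x ∈ D u := hF₁ _ (hDcard u huS) p hp hxp
          have hxS : x ∉ S := by
            obtain ⟨w⟩ := (Finset.mem_filter.1 hxD).2.symm
            cases w with
            | nil => exact huS
            | cons h _ => exact h.2.1
          rw [if_neg hxS, hDeq u x hxD]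
          exact Finset.mem_filter.2 ⟨hp, hxp⟩
      refine (Finset.card_le_card hsub).trans ((Finset.card_union_le _ _).trans ?_)
      have h1 : (S.image fun v => (K, v)).card ≤ q := Finset.card_image_le.trans hSq
      rw [mul_add_one, add_comm]
      refine add_le_add ?_ h1
      split_ifs with hx
      · simp
      · exact hF₂ _ (hDcard x hx) x
    · have hxK := hw x w.start_mem_support
      have hyK := hw y w.end_mem_support
      by_cases hmeet : ∃ z ∈ w.support, z ∈ S
      · obtain ⟨z, hzw, hzS⟩ := hmeet
        exact ⟨(K, z), Finset.mem_union_left _ (Finset.mem_image_of_mem _ hzS), hxK, hyK, hzw⟩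
      · push Not at hmeet
        have hreach : ∀ (a b : V) (w : G.graph.Walk a b), (∀ z ∈ w.support, z ∉ S) →
            ∀ z ∈ w.support, (G.removeVerts S).graph.Reachable a z := by
          intro a b w
          induction w with
          | nil =>
            intro _ z hz
            rw [SimpleGraph.Walk.support_nil, List.mem_singleton] at hz
            exact hz ▸ .refl _
          | cons hab w ih =>
            intro hS z hz
            rw [SimpleGraph.Walk.support_cons, List.mem_cons] at hz
            rcases hz with rfl | hz
            · exact .refl _
            · refine SimpleGraph.Reachable.trans (SimpleGraph.Adj.reachable ?_)
                (ih (fun z hz => hS z (by simp [hz])) z hz)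
              exact ⟨hab, hS _ (by simp), hS _ (by simp)⟩
        have hxS := hmeet x w.start_mem_support
        obtain ⟨p, hp, hpxy⟩ := hF₃ (D x) (hDcard x hxS) x y w fun z hz =>
          Finset.mem_filter.2 ⟨hw z hz, hreach x y w hmeet z hz⟩
        exact ⟨p, Finset.mem_union_right _ (Finset.mem_biUnion.2
          ⟨x, Finset.mem_sdiff.2 ⟨hxK, hxS⟩, hp⟩), hpxy⟩

/-- A distance is the infimum over all walks, each of which passes through one of finitely many
centres; so some centre lies on a shortest connection. -/
theorem exists_cluster_dist_add_dist_le {G : WeightedGraph V} (F : Finset (Finset V × V))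
    (hF : ∀ (x y : V) (w : G.graph.Walk x y), ∃ p ∈ F, x ∈ p.1 ∧ y ∈ p.1 ∧ p.2 ∈ w.support)
    {x y : V} (hxy : G.dist x y ≠ ∞) :
    ∃ p ∈ F, x ∈ p.1 ∧ y ∈ p.1 ∧ G.dist x p.2 + G.dist p.2 y ≤ G.dist x y := by
  classical
  obtain ⟨w₀⟩ := G.nonempty_walk_of_dist_ne_top hxy
  obtain ⟨p₀, hp₀, hx₀, hy₀, -⟩ := hF x y w₀
  obtain ⟨p, hp, hmin⟩ := (F.filter fun p => x ∈ p.1 ∧ y ∈ p.1).exists_min_image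
    (fun p => G.dist x p.2 + G.dist p.2 y) ⟨p₀, Finset.mem_filter.2 ⟨hp₀, hx₀, hy₀⟩⟩
  rw [Finset.mem_filter] at hp
  refine ⟨p, hp.1, hp.2.1, hp.2.2, le_iInf fun w => ?_⟩
  obtain ⟨r, hr, hxr, hyr, hrw⟩ := hF x y w
  exact (hmin r (Finset.mem_filter.2 ⟨hr, hxr, hyr⟩)).trans (G.dist_add_dist_le_walkWeight w hrw)

end WeightedGraph

/-! ### Independent sampling -/

/-- The probability of the outcome `ω` when each `a` is sampled (`ω a = true`) independently with
probability `p a`. -/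
noncomputable def bernoulliWeight {α : Type*} [Fintype α] (p : α → ℝ) (ω : α → Bool) : ℝ :=
  ∏ a, if ω a then p a else 1 - p a

theorem bernoulliWeight_nonneg {α : Type*} [Fintype α] {p : α → ℝ} (h₀ : ∀ a, 0 ≤ p a)
    (h₁ : ∀ a, p a ≤ 1) (ω : α → Bool) :
    0 ≤ bernoulliWeight p ω :=
  Finset.prod_nonneg fun a _ => by
    split_ifs
    · exact h₀ a
    · exact sub_nonneg.2 (h₁ a)

section Bernoulli

variable {α : Type*} [Fintype α] [DecidableEq α]

/-- The expectation of a product of independent variables is the product of the expectations. -/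
theorem sum_bernoulliWeight_mul_prod (p : α → ℝ) (g : α → Bool → ℝ) :
    ∑ ω, bernoulliWeight p ω * ∏ a, g a (ω a) =
      ∏ a, (p a * g a true + (1 - p a) * g a false) := by
  have h : ∀ a, p a * g a true + (1 - p a) * g a false =
      ∑ b : Bool, (if b then p a else 1 - p a) * g a b := fun a => by simp
  simp_rw [h, Fintype.prod_sum, bernoulliWeight, ← Finset.prod_mul_distrib]

theorem sum_bernoulliWeight (p : α → ℝ) : ∑ ω, bernoulliWeight p ω = 1 := by
  simpa using sum_bernoulliWeight_mul_prod p fun _ _ => 1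

theorem sum_bernoulliWeight_forall_eq_false (p : α → ℝ) (T : Finset α) :
    (∑ ω, bernoulliWeight p ω * if ∀ a ∈ T, ω a = false then 1 else 0) = ∏ a ∈ T, (1 - p a) := by
  have h := sum_bernoulliWeight_mul_prod p fun a b => if a ∈ T ∧ b = true then 0 else 1
  have h2 : ∀ ω : α → Bool, (∏ a, if a ∈ T ∧ ω a = true then (0 : ℝ) else 1) =
      if ∀ a ∈ T, ω a = false then 1 else 0 := fun ω => by
    split_ifs with hω
    · exact Finset.prod_eq_one fun a _ => if_neg fun ha => by simp [hω a ha.1] at ha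
    · push Not at hω
      obtain ⟨a, ha, hωa⟩ := hω
      exact Finset.prod_eq_zero (Finset.mem_univ a) (if_pos ⟨ha, by simpa using hωa⟩)
  simp_rw [h2] at h
  rw [h, ← Finset.prod_subset (Finset.subset_univ T)]
  · exact Finset.prod_congr rfl fun a ha => by simp [ha]
  · intro a _ ha
    simp [ha]

theorem sum_bernoulliWeight_eq_true (p : α → ℝ) (a : α) :
    (∑ ω, bernoulliWeight p ω * if ω a then 1 else 0) = p a := by
  have h1 := sum_bernoulliWeight_forall_eq_false p {a}
  have h2 := sum_bernoulliWeight p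
  have h3 : ∀ ω : α → Bool, (bernoulliWeight p ω * if ω a then 1 else 0) =
      bernoulliWeight p ω - bernoulliWeight p ω * if ∀ b ∈ ({a} : Finset α), ω b = false
        then 1 else 0 := fun ω => by
    cases h : ω a <;> simp [h]
  simp_rw [h3, Finset.sum_sub_distrib]
  rw [h1, h2]
  simp

end Bernoulli

/-- Conditioning on the event that `X` is at most twice its mean: by Markov's inequality this
event has probability at least `1 / 2`, so expectations at most double. -/
theorem exists_pmf_le_two_mul_mean {Ω : Type*} [Fintype Ω] (W X : Ω → ℝ) (hW : ∀ ω, 0 ≤ W ω)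
    (hW1 : ∑ ω, W ω = 1) (hX : ∀ ω, 0 ≤ X ω) {M : ℝ} (hM : 0 < M) (hXM : ∑ ω, W ω * X ω ≤ M) :
    ∃ Q : PMF Ω, (∀ ω ∈ Q.support, X ω ≤ 2 * M) ∧
      ∀ Y : Ω → ℕ, ∑ ω, Q ω * (Y ω : ℝ≥0∞) ≤ ENNReal.ofReal (2 * ∑ ω, W ω * Y ω) := by
  classical
  set W' : Ω → ℝ := fun ω => if X ω ≤ 2 * M then W ω else 0 with hW'
  have hW'0 : ∀ ω, 0 ≤ W' ω := fun ω => by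
    simp only [hW']
    split_ifs
    · exact hW ω
    · exact le_rfl
  have hW'le : ∀ ω, W' ω ≤ W ω := fun ω => by
    simp only [hW']
    split_ifs
    · exact le_rfl
    · exact hW ω
  set Z := ∑ ω, W' ω with hZ
  have hZ2 : 1 / 2 ≤ Z := by
    have h : ∀ ω, W ω ≤ W' ω + W ω * X ω / (2 * M) := fun ω => by
      have := hW ω
      have := hX ω
      simp only [hW']
      split_ifs with h
      · have : 0 ≤ W ω * X ω / (2 * M) := by positivity
        linarith
      · rw [zero_add, le_div_iff₀ (by positivity)]
        exact mul_le_mul_of_nonneg_left (not_le.1 h).le (hW ω)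
    have h2 := Finset.sum_le_sum fun ω (_ : ω ∈ Finset.univ) => h ω
    rw [Finset.sum_add_distrib, ← Finset.sum_div, hW1] at h2
    have h3 : (∑ ω, W ω * X ω) / (2 * M) ≤ 1 / 2 := by
      rw [div_le_div_iff₀ (by positivity) (by norm_num)]
      linarith
    linarith
  have hZ0 : 0 < Z := by linarith
  refine ⟨PMF.ofFintype (fun ω => ENNReal.ofReal (W' ω / Z)) ?_, fun ω hω => ?_, fun Y => ?_⟩
  · rw [← ENNReal.ofReal_sum_of_nonneg fun ω _ => div_nonneg (hW'0 ω) hZ0.le, ← Finset.sum_div,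
      ← hZ, div_self hZ0.ne', ENNReal.ofReal_one]
  · by_contra h
    rw [PMF.mem_support_iff, PMF.ofFintype_apply] at hω
    exact hω (by simp [hW', h])
  · simp only [PMF.ofFintype_apply]
    have h : ∀ ω, ENNReal.ofReal (W' ω / Z) * (Y ω : ℝ≥0∞) = ENNReal.ofReal (W' ω / Z * Y ω) :=
      fun ω => by
        rw [ENNReal.ofReal_mul (div_nonneg (hW'0 ω) hZ0.le), ENNReal.ofReal_natCast]
    simp_rw [h]
    rw [← ENNReal.ofReal_sum_of_nonneg fun ω _ =>
      mul_nonneg (div_nonneg (hW'0 ω) hZ0.le) (Nat.cast_nonneg _), Finset.mul_sum]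
    refine ENNReal.ofReal_le_ofReal (Finset.sum_le_sum fun ω _ => ?_)
    rw [← mul_assoc]
    refine mul_le_mul_of_nonneg_right ?_ (Nat.cast_nonneg _)
    rw [div_le_iff₀ hZ0]
    nlinarith [hW ω, hW'le ω]

/-! ### Sampling in a linear order -/

/-- The probability with which the element of rank `j` (counted from `0`) is sampled. -/
noncomputable def sampleProb (s j : ℕ) : ℝ := min 1 (s / (j + 1))

theorem sampleProb_nonneg (s j : ℕ) : 0 ≤ sampleProb s j := le_min zero_le_one (by positivity)

theorem sampleProb_le_one (s j : ℕ) : sampleProb s j ≤ 1 := min_le_left _ _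

theorem sum_sampleProb_le (s m : ℕ) :
    ∑ j ∈ Finset.range m, sampleProb s j ≤ s * (1 + Real.log m) := by
  have h := harmonic_le_one_add_log m
  rw [harmonic] at h
  push_cast at h
  refine le_trans (Finset.sum_le_sum fun j _ => min_le_right _ _) ?_
  simp_rw [div_eq_mul_inv]
  rw [← Finset.mul_sum]
  exact mul_le_mul_of_nonneg_left h (Nat.cast_nonneg _)

/-- Let `β` be the set of attacked ranks, and call a surviving rank lost if no surviving rank up
to it is sampled. The summand at `j` is the probability that `j` is lost. With `A` the sum up to
rank `m` and `Q` the probability that no survivor below `m` is sampled, the quantity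
`(s - 1) * A + Q * (m + 1 - s)⁺` does not change at a survivor of rank at least `s - 1`, does not
increase at a survivor of smaller rank (it is sampled for sure), and grows by at most one at an
attacked rank. -/
theorem sum_prod_sampleProb_le {s : ℕ} (hs : 1 ≤ s) (β : ℕ → Prop) [DecidablePred β] (m : ℕ) :
    (s - 1 : ℝ) * (∑ j ∈ Finset.range m, if β j then 0 else
      ∏ l ∈ Finset.range (j + 1), if β l then 1 else 1 - sampleProb s l) +
      (∏ l ∈ Finset.range m, if β l then 1 else 1 - sampleProb s l) * ((m + 1 - s : ℕ) : ℝ) ≤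
      ((Finset.range m).filter β).card := by
  have hQ : ∀ m, 0 ≤ (∏ l ∈ Finset.range m, if β l then 1 else 1 - sampleProb s l) ∧
      (∏ l ∈ Finset.range m, if β l then 1 else 1 - sampleProb s l) ≤ 1 := fun m => by
    have h : ∀ l, 0 ≤ (if β l then 1 else 1 - sampleProb s l) ∧
        (if β l then 1 else 1 - sampleProb s l) ≤ 1 := fun l => by
      have := sampleProb_nonneg s l
      have := sampleProb_le_one s l
      split_ifs <;> constructor <;> linarith
    exact ⟨Finset.prod_nonneg fun l _ => (h l).1,
      Finset.prod_le_one (fun l _ => (h l).1) fun l _ => (h l).2⟩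
  induction m with
  | zero => simp [Nat.sub_eq_zero_of_le hs]
  | succ m ih =>
    rw [Finset.sum_range_succ, Finset.prod_range_succ, Finset.range_add_one, Finset.filter_insert]
    obtain ⟨hQ0, hQ1⟩ := hQ m
    set A := ∑ j ∈ Finset.range m, if β j then (0 : ℝ) else
      ∏ l ∈ Finset.range (j + 1), if β l then 1 else 1 - sampleProb s l
    set Q := ∏ l ∈ Finset.range m, if β l then (1 : ℝ) else 1 - sampleProb s l
    by_cases hm : β m
    · simp only [hm, if_true, add_zero, mul_one]
      rw [Finset.card_insert_of_notMem (by simp)]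
      have h : ((m + 1 + 1 - s : ℕ) : ℝ) ≤ ((m + 1 - s : ℕ) : ℝ) + 1 := by
        exact_mod_cast (by omega : m + 1 + 1 - s ≤ m + 1 - s + 1)
      push_cast
      nlinarith [mul_le_mul_of_nonneg_left h hQ0]
    · simp only [hm, if_false]
      have hm1 : (0 : ℝ) < m + 1 := by positivity
      rcases le_total s (m + 1) with hsm | hsm
      · have hp : (1 - sampleProb s m) * (m + 1) = ((m + 1 - s : ℕ) : ℝ) := by
          rw [sampleProb, min_eq_right, sub_mul, div_mul_cancel₀ _ hm1.ne', Nat.cast_sub hsm]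
          · push_cast; ring
          · rw [div_le_one hm1]; exact_mod_cast hsm
        have h2 : ((m + 1 + 1 - s : ℕ) : ℝ) = m + 2 - s := by
          rw [Nat.cast_sub (by omega)]; push_cast; ring
        rw [h2]
        calc _ = (s - 1 : ℝ) * A + Q * ((1 - sampleProb s m) * (m + 1)) := by ring
          _ ≤ _ := by rw [hp]; exact ih
      · have hp : sampleProb s m = 1 := by
          refine min_eq_left ?_
          rw [le_div_iff₀ hm1, one_mul]
          exact_mod_cast hsm
        rw [hp]
        have : 0 ≤ Q * ((m + 1 - s : ℕ) : ℝ) := mul_nonneg hQ0 (Nat.cast_nonneg _)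
        linarith

/-- A ranking of `K` by the key `f`, with ties broken arbitrarily. -/
theorem exists_rank {V : Type*} [DecidableEq V] {β : Type*} [LinearOrder β] (f : V → β)
    (K : Finset V) : ∃ r : V → ℕ, Set.InjOn r K ∧ K.image r = Finset.range K.card ∧
      ∀ x ∈ K, ∀ y ∈ K, r x ≤ r y → f x ≤ f y := by
  induction K using Finset.induction_on_max_value f with
  | empty => exact ⟨fun _ => 0, by simp⟩
  | insert a K ha hmax ih =>
    obtain ⟨r, hinj, himg, hmono⟩ := ih
    have hlt : ∀ x ∈ K, r x < K.card := fun x hx => by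
      rw [← Finset.mem_range, ← himg]
      exact Finset.mem_image_of_mem r hx
    have hne : ∀ x ∈ K, x ≠ a := fun x hx h => ha (h ▸ hx)
    refine ⟨Function.update r a K.card, ?_, ?_, ?_⟩
    · intro x hx y hy hxy
      rw [Finset.mem_coe, Finset.mem_insert] at hx hy
      rcases hx with rfl | hx <;> rcases hy with rfl | hy
      · rfl
      · rw [Function.update_self, Function.update_of_ne (hne y hy)] at hxy
        exact absurd (hlt y hy) (by omega)
      · rw [Function.update_self, Function.update_of_ne (hne x hx)] at hxy
        exact absurd (hlt x hx) (by omega)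
      · rw [Function.update_of_ne (hne x hx), Function.update_of_ne (hne y hy)] at hxy
        exact hinj hx hy hxy
    · rw [Finset.image_insert, Function.update_self, Finset.card_insert_of_notMem ha,
        Finset.range_add_one, ← himg]
      congr 1
      exact Finset.image_congr fun x hx => Function.update_of_ne (hne x hx) _ _
    · intro x hx y hy hxy
      rw [Finset.mem_insert] at hx hy
      rcases hx with rfl | hx <;> rcases hy with rfl | hy
      · exact le_rfl
      · rw [Function.update_self, Function.update_of_ne (hne y hy)] at hxy
        exact absurd (hlt y hy) (by omega)
      · exact hmax x hx
      · rw [Function.update_of_ne (hne x hx), Function.update_of_ne (hne y hy)] at hxy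
        exact hmono x hx y hy hxy

/-- When the elements of `K` are sampled by rank, the expected number of elements outside `B` that
are preceded by no sampled element outside `B` is at most `|K ∩ B| / (s - 1)`. -/
theorem sum_prod_rank_le {V : Type*} [DecidableEq V] {s : ℕ} (hs : 2 ≤ s) {K : Finset V}
    {r : V → ℕ} (hinj : Set.InjOn r K) (himg : K.image r = Finset.range K.card) (B : Finset V) :
    ∑ x ∈ K \ B, ∏ x' ∈ (K \ B).filter (fun x' => r x' ≤ r x), (1 - sampleProb s (r x')) ≤
      (K ∩ B).card / (s - 1 : ℝ) := by
  have hs1 : (0 : ℝ) < s - 1 := by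
    have : (2 : ℝ) ≤ s := by exact_mod_cast hs
    linarith
  rw [le_div_iff₀ hs1, mul_comm]
  have hβ : ∀ x ∈ K, r x ∈ (K ∩ B).image r ↔ x ∈ B := fun x hx => by
    rw [Finset.mem_image]
    constructor
    · rintro ⟨y, hy, hyx⟩
      rw [Finset.mem_inter] at hy
      exact hinj hy.1 hx hyx ▸ hy.2
    · exact fun hxB => ⟨x, Finset.mem_inter.2 ⟨hx, hxB⟩, rfl⟩
  have hmain := sum_prod_sampleProb_le (by omega : 1 ≤ s) (fun j => j ∈ (K ∩ B).image r) K.card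
  have hcard : ((Finset.range K.card).filter fun j => j ∈ (K ∩ B).image r).card ≤
      (K ∩ B).card := by
    rw [Finset.filter_mem_eq_inter]
    exact (Finset.card_le_card Finset.inter_subset_right).trans Finset.card_image_le
  have hQ : 0 ≤ (∏ l ∈ Finset.range K.card, if l ∈ (K ∩ B).image r then (1 : ℝ) else
      1 - sampleProb s l) * ((K.card + 1 - s : ℕ) : ℝ) := by
    refine mul_nonneg (Finset.prod_nonneg fun l _ => ?_) (Nat.cast_nonneg _)
    have := sampleProb_le_one s l
    split_ifs <;> linarith
  have hsum : (∑ x ∈ K \ B, ∏ x' ∈ (K \ B).filter (fun x' => r x' ≤ r x),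
      (1 - sampleProb s (r x'))) = ∑ j ∈ Finset.range K.card, if j ∈ (K ∩ B).image r then 0 else
      ∏ l ∈ Finset.range (j + 1), if l ∈ (K ∩ B).image r then 1 else 1 - sampleProb s l := by
    rw [← himg, Finset.sum_image hinj, Finset.sdiff_eq_filter, Finset.sum_filter]
    refine Finset.sum_congr rfl fun x hx => ?_
    simp only [hβ x hx, ite_not]
    congr 1
    have hr : Finset.range (r x + 1) = (K.filter fun x' => r x' ≤ r x).image r := by
      ext l
      have hx' : r x ∈ Finset.range K.card := himg ▸ Finset.mem_image_of_mem r hx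
      have hl : l ∈ K.image r ↔ l < K.card := by rw [himg, Finset.mem_range]
      simp only [Finset.mem_range, Finset.mem_image, Finset.mem_filter] at hx' hl ⊢
      constructor
      · intro hlx
        obtain ⟨y, hy, rfl⟩ := hl.2 (by omega)
        exact ⟨y, ⟨hy, by omega⟩, rfl⟩
      · rintro ⟨y, ⟨_, hyx⟩, rfl⟩
        omega
    rw [hr, Finset.prod_image (hinj.mono fun y hy => (Finset.mem_filter.1 hy).1),
      Finset.filter_filter, ← Finset.filter_filter, Finset.filter_comm, Finset.prod_filter]
    refine Finset.prod_congr rfl fun y hy => ?_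
    simp only [hβ y (Finset.mem_filter.1 hy).1, ite_not]
  rw [hsum]
  have : ((((Finset.range K.card).filter fun j => j ∈ (K ∩ B).image r).card : ℕ) : ℝ) ≤
    (K ∩ B).card := by exact_mod_cast hcard
  linarith

/-! ### The random spanner -/

namespace WeightedGraph

variable {V : Type*}

/-- The spanner for the outcome `ω` of the sampling: in each cluster `p` of `F`, ranked by `r p`,
every sampled vertex is joined to all vertices of higher rank. Edges have the length of the
distance in `G`; pairs at infinite distance are left out. -/
noncomputable def sampledSpanner (G : WeightedGraph V) (F : Finset (Finset V × V))
    (r : Finset V × V → V → ℕ) (ω : (Finset V × V) × V → Bool) : WeightedGraph V where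
  graph := SimpleGraph.fromRel fun a b => G.dist a b ≠ ∞ ∧
    ∃ p ∈ F, a ∈ p.1 ∧ b ∈ p.1 ∧ ω (p, a) = true ∧ r p a ≤ r p b
  weight := Sym2.lift ⟨fun a b => (G.dist a b).toNNReal, fun a b => congrArg ENNReal.toNNReal (G.dist_comm a b)⟩

variable {G : WeightedGraph V} {F : Finset (Finset V × V)} {r : Finset V × V → V → ℕ}

theorem sampledSpanner_dominates (ω : (Finset V × V) × V → Bool) :
    (G.sampledSpanner F r ω).Dominates G.dist := by
  refine dominates_of_forall_adj _ _ fun x y h => ?_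
  have hne : G.dist x y ≠ ∞ := by
    rcases h.2 with h | h
    · exact h.1
    · rw [G.dist_comm]; exact h.1
  change G.dist x y ≤ ((G.dist x y).toNNReal : ℝ≥0∞)
  rw [ENNReal.coe_toNNReal hne]

theorem dist_sampledSpanner_removeVerts_le {ω : (Finset V × V) × V → Bool} {B : Finset V}
    {p : Finset V × V} (hp : p ∈ F) {a b : V} (ha : a ∈ p.1) (hb : b ∈ p.1) (haB : a ∉ B)
    (hbB : b ∉ B) (hω : ω (p, a) = true) (hab : r p a ≤ r p b) :
    ((G.sampledSpanner F r ω).removeVerts B).dist a b ≤ G.dist a b := by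
  by_cases htop : G.dist a b = ∞
  · rw [htop]; exact le_top
  rcases eq_or_ne a b with rfl | hne
  · simp
  have hadj : ((G.sampledSpanner F r ω).removeVerts B).graph.Adj a b :=
    ⟨⟨hne, Or.inl ⟨htop, p, hp, ha, hb, hω, hab⟩⟩, haB, hbB⟩
  refine (dist_le_weight _ hadj).trans ?_
  change ((G.dist a b).toNNReal : ℝ≥0∞) ≤ _
  rw [ENNReal.coe_toNNReal htop]

variable [DecidableEq V]

theorem numEdges_sampledSpanner_le (ω : (Finset V × V) × V → Bool) :
    (G.sampledSpanner F r ω).numEdges ≤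
      ∑ p ∈ F, (p.1.filter fun a => ω (p, a) = true).card * p.1.card := by
  have hsub : (G.sampledSpanner F r ω).graph.edgeSet ⊆
      (F.biUnion fun p => ((p.1.filter fun a => ω (p, a) = true) ×ˢ p.1).image
        fun ab => s(ab.1, ab.2) : Finset (Sym2 V)) := by
    intro e
    induction e with
    | h a b =>
      intro he
      rw [Finset.mem_coe, Finset.mem_biUnion]
      rcases he.2 with ⟨-, p, hp, ha, hb, hω, -⟩ | ⟨-, p, hp, hb, ha, hω, -⟩
      · refine ⟨p, hp, Finset.mem_image.2 ⟨(a, b), ?_, rfl⟩⟩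
        exact Finset.mem_product.2 ⟨Finset.mem_filter.2 ⟨ha, hω⟩, hb⟩
      · refine ⟨p, hp, Finset.mem_image.2 ⟨(b, a), ?_, Sym2.eq_swap⟩⟩
        exact Finset.mem_product.2 ⟨Finset.mem_filter.2 ⟨hb, hω⟩, ha⟩
  refine (Set.ncard_le_ncard hsub (Finset.finite_toSet _)).trans ?_
  rw [Set.ncard_coe_finset]
  refine Finset.card_biUnion_le.trans (Finset.sum_le_sum fun p _ => ?_)
  exact Finset.card_image_le.trans (Finset.card_product _ _).le

/-- The vertices outside `B` of the cluster `p` that are preceded by no sampled survivor of the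
attack `B`. -/
def lostVertices (r : Finset V × V → V → ℕ) (ω : (Finset V × V) × V → Bool) (B : Finset V)
    (p : Finset V × V) : Finset V :=
  (p.1 \ B).filter fun x => ∀ x' ∈ (p.1 \ B).filter (fun x' => r p x' ≤ r p x), ω (p, x') = false

/-- Let `x` precede `y` in a cluster whose centre `v` lies on a shortest connection between them.
A sampled survivor `x'` that precedes `x` is at least as close to `v` as `x`, and `x` is at least
as close as `y`; so the detour over `x'` costs at most `3 d(x, v) + d(v, y) ≤ 2 d(x, y)`. -/
theorem dist_sampledSpanner_le_two_mul {ω : (Finset V × V) × V → Bool} {B : Finset V}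
    {p : Finset V × V} (hp : p ∈ F)
    (hr : ∀ a ∈ p.1, ∀ b ∈ p.1, r p a ≤ r p b → G.dist p.2 a ≤ G.dist p.2 b)
    {x y : V} (hx : x ∈ p.1) (hy : y ∈ p.1) (hxB : x ∉ B) (hyB : y ∉ B)
    (hxy : G.dist x p.2 + G.dist p.2 y ≤ G.dist x y) (hrxy : r p x ≤ r p y)
    (hlost : x ∉ lostVertices r ω B p) :
    ((G.sampledSpanner F r ω).removeVerts B).dist x y ≤ 2 * G.dist x y := by
  obtain ⟨x', hx', hω⟩ : ∃ x' ∈ (p.1 \ B).filter (fun x' => r p x' ≤ r p x),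
      ω (p, x') = true := by
    by_contra! h
    exact hlost (Finset.mem_filter.2 ⟨Finset.mem_sdiff.2 ⟨hx, hxB⟩, fun x' hx' => by
      simpa using h x' hx'⟩)
  rw [Finset.mem_filter, Finset.mem_sdiff] at hx'
  obtain ⟨⟨hx'p, hx'B⟩, hx'r⟩ := hx'
  have h1 := dist_sampledSpanner_removeVerts_le (G := G) hp hx'p hx hx'B hxB hω hx'r
  have h2 := dist_sampledSpanner_removeVerts_le (G := G) hp hx'p hy hx'B hyB hω (hx'r.trans hrxy)
  have h3 := hr x' hx'p x hx hx'r
  have h4 := hr x hx y hy hrxy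
  rw [G.dist_comm x] at hxy
  calc ((G.sampledSpanner F r ω).removeVerts B).dist x y
      ≤ G.dist x' x + G.dist x' y := by
        refine (dist_triangle _ x x' y).trans (add_le_add ?_ h2)
        rw [dist_comm]
        exact h1
    _ ≤ (G.dist x' p.2 + G.dist p.2 x) + (G.dist x' p.2 + G.dist p.2 y) :=
        add_le_add (G.dist_triangle _ _ _) (G.dist_triangle _ _ _)
    _ ≤ (G.dist p.2 x + G.dist p.2 x) + (G.dist p.2 y + G.dist p.2 y) := by
        rw [G.dist_comm x']
        exact add_le_add (add_le_add_left h3 _) (add_le_add_left (h3.trans h4) _)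
    _ = 2 * (G.dist p.2 x + G.dist p.2 y) := by ring
    _ ≤ 2 * G.dist x y := mul_le_mul_right hxy 2

theorem dist_sampledSpanner_removeVerts_le_two_mul
    (hF : ∀ x y, G.dist x y ≠ ∞ →
      ∃ p ∈ F, x ∈ p.1 ∧ y ∈ p.1 ∧ G.dist x p.2 + G.dist p.2 y ≤ G.dist x y)
    (hr : ∀ p ∈ F, ∀ a ∈ p.1, ∀ b ∈ p.1, r p a ≤ r p b → G.dist p.2 a ≤ G.dist p.2 b)
    (ω : (Finset V × V) × V → Bool) (B : Finset V) {x y : V}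
    (hx : x ∉ B ∪ F.biUnion (lostVertices r ω B)) (hy : y ∉ B ∪ F.biUnion (lostVertices r ω B)) :
    ((G.sampledSpanner F r ω).removeVerts B).dist x y ≤ 2 * G.dist x y := by
  by_cases htop : G.dist x y = ∞
  · rw [htop, ENNReal.mul_top two_ne_zero]; exact le_top
  obtain ⟨p, hp, hxp, hyp, hxy⟩ := hF x y htop
  simp only [Finset.mem_union, Finset.mem_biUnion, not_or, not_exists, not_and] at hx hy
  rcases le_total (r p x) (r p y) with h | h
  · exact dist_sampledSpanner_le_two_mul hp (hr p hp) hxp hyp hx.1 hy.1 hxy h (hx.2 p hp)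
  · rw [dist_comm, G.dist_comm x]
    refine dist_sampledSpanner_le_two_mul hp (hr p hp) hyp hxp hy.1 hx.1 ?_ h (hy.2 p hp)
    rwa [add_comm, G.dist_comm p.2, G.dist_comm y, G.dist_comm y]

variable [Fintype V]

/-- The probability of sampling `a` in the cluster `p` depends on the rank of `a` in `p`. -/
noncomputable def clusterProb (s : ℕ) (r : Finset V × V → V → ℕ) (a : (Finset V × V) × V) : ℝ :=
  sampleProb s (r a.1 a.2)

theorem sum_card_lostVertices_le {s τ : ℕ} (hs : 2 ≤ s)
    (hτ : ∀ x, (F.filter fun p => x ∈ p.1).card ≤ τ)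
    (hinj : ∀ p ∈ F, Set.InjOn (r p) p.1)
    (himg : ∀ p ∈ F, p.1.image (r p) = Finset.range p.1.card) (B : Finset V) :
    ∑ ω, bernoulliWeight (clusterProb s r) ω *
      ((∑ p ∈ F, (lostVertices r ω B p).card : ℕ) : ℝ) ≤ τ * B.card / (s - 1 : ℝ) := by
  have hs1 : (0 : ℝ) < s - 1 := by
    have : (2 : ℝ) ≤ s := by exact_mod_cast hs
    linarith
  have hone : ∀ p ∈ F, ∑ ω, bernoulliWeight (clusterProb s r) ω *
      ((lostVertices r ω B p).card : ℝ) ≤ (p.1 ∩ B).card / (s - 1 : ℝ) := by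
    intro p hp
    refine le_trans (le_of_eq ?_) (sum_prod_rank_le hs (hinj p hp) (himg p hp) B)
    simp only [lostVertices, Finset.card_filter, Nat.cast_sum, Finset.mul_sum]
    rw [Finset.sum_comm]
    refine Finset.sum_congr rfl fun x _ => ?_
    have h := sum_bernoulliWeight_forall_eq_false (clusterProb s r)
      (((p.1 \ B).filter fun x' => r p x' ≤ r p x).image fun x' => (p, x'))
    rw [Finset.prod_image fun a _ b _ hab => (Prod.mk.inj hab).2] at h
    refine Eq.trans (Finset.sum_congr rfl fun ω _ => ?_) h
    simp only [Finset.forall_mem_image, Nat.cast_ite, Nat.cast_one, Nat.cast_zero]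
  have hswap : ∑ p ∈ F, (p.1 ∩ B).card ≤ τ * B.card := by
    have h : ∀ p : Finset V × V, (p.1 ∩ B).card = ∑ x ∈ B, if x ∈ p.1 then 1 else 0 := fun p => by
      rw [← Finset.card_filter, Finset.inter_comm, Finset.filter_mem_eq_inter]
    simp_rw [h]
    rw [Finset.sum_comm]
    simp_rw [← Finset.card_filter]
    rw [mul_comm]
    exact Finset.sum_le_card_nsmul _ _ _ fun x _ => hτ x
  simp only [Nat.cast_sum, Finset.mul_sum]
  rw [Finset.sum_comm]
  refine (Finset.sum_le_sum hone).trans ?_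
  rw [← Finset.sum_div]
  exact div_le_div_of_nonneg_right (by exact_mod_cast hswap) hs1.le

theorem sum_card_sampled_mul_card_le {s τ : ℕ}
    (hτ : ∀ x, (F.filter fun p => x ∈ p.1).card ≤ τ)
    (hinj : ∀ p ∈ F, Set.InjOn (r p) p.1)
    (himg : ∀ p ∈ F, p.1.image (r p) = Finset.range p.1.card) :
    ∑ ω, bernoulliWeight (clusterProb s r) ω *
      ((∑ p ∈ F, (p.1.filter fun a => ω (p, a) = true).card * p.1.card : ℕ) : ℝ) ≤
      Fintype.card V * τ * (s * (1 + Real.log (Fintype.card V))) := by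
  have hlog : (0 : ℝ) ≤ Real.log (Fintype.card V) := Real.log_natCast_nonneg _
  have hone : ∀ p ∈ F, ∑ ω, bernoulliWeight (clusterProb s r) ω *
      (((p.1.filter fun a => ω (p, a) = true).card * p.1.card : ℕ) : ℝ) ≤
      p.1.card * (s * (1 + Real.log (Fintype.card V))) := by
    intro p hp
    have h1 : ∑ ω, bernoulliWeight (clusterProb s r) ω *
        ((p.1.filter fun a => ω (p, a) = true).card : ℝ) ≤
        s * (1 + Real.log (Fintype.card V)) := by
      simp only [Finset.card_filter, Nat.cast_sum, Finset.mul_sum]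
      rw [Finset.sum_comm]
      have h2 : ∀ a ∈ p.1, (∑ ω, bernoulliWeight (clusterProb s r) ω *
          ((if ω (p, a) = true then 1 else 0 : ℕ) : ℝ)) = sampleProb s (r p a) := fun a _ => by
        rw [← show clusterProb s r (p, a) = sampleProb s (r p a) from rfl,
          ← sum_bernoulliWeight_eq_true (clusterProb s r) (p, a)]
        simp only [Nat.cast_ite, Nat.cast_one, Nat.cast_zero]
      rw [Finset.sum_congr rfl h2, ← Finset.sum_image (hinj p hp), himg p hp]
      refine le_trans (Finset.sum_le_sum_of_subset_of_nonneg (Finset.range_subset_range.2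
        (Finset.card_le_univ p.1)) fun j _ _ => sampleProb_nonneg s j) ?_
      exact sum_sampleProb_le s _
    simp only [Nat.cast_mul, ← mul_assoc]
    rw [← Finset.sum_mul, mul_comm]
    exact (mul_le_mul_of_nonneg_left h1 (Nat.cast_nonneg _)).trans (by rw [mul_assoc])
  have hswap : ∑ p ∈ F, p.1.card ≤ Fintype.card V * τ := by
    have h : ∀ p : Finset V × V, p.1.card = ∑ x : V, if x ∈ p.1 then 1 else 0 := fun p => by
      rw [← Finset.card_filter, Finset.filter_mem_eq_inter, Finset.univ_inter]
    simp_rw [h]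
    rw [Finset.sum_comm]
    simp_rw [← Finset.card_filter]
    exact Finset.sum_le_card_nsmul _ _ _ fun x _ => hτ x
  rw [Finset.sum_congr rfl fun ω _ => by rw [Nat.cast_sum, Finset.mul_sum], Finset.sum_comm]
  refine (Finset.sum_le_sum hone).trans ?_
  rw [← Finset.sum_mul]
  exact mul_le_mul_of_nonneg_right (by exact_mod_cast hswap) (by positivity)

/-- A distribution over outcomes `ω` with a faulty extension for each outcome yields a reliable
spanner. The faulty extension may only depend on the graph `H ω`, not on `ω` itself; a smallest
admissible one is taken for each graph. -/
theorem exists_isObliviousReliableSpanner_map {Ω : Type*} [Fintype Ω] (d : V → V → ℝ≥0∞)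
    (ν t : ℝ≥0) (Q : PMF Ω) (H : Ω → WeightedGraph V) (hdom : ∀ ω, (H ω).Dominates d)
    (E : Finset V → Ω → Finset V) (hE : ∀ B ω, B ⊆ E B ω)
    (hstretch : ∀ B ω x y, x ∉ E B ω → y ∉ E B ω → ((H ω).removeVerts B).dist x y ≤ t * d x y)
    (hexp : ∀ B : Finset V, ∑ ω, Q ω * ((E B ω).card : ℝ≥0∞) ≤ (1 + ν) * (B.card : ℝ≥0∞)) :
    IsObliviousReliableSpanner d ν t (Q.map H) := by
  classical
  refine ⟨fun H' hH' => ?_, fun B => ?_⟩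
  · rw [PMF.support_map] at hH'
    obtain ⟨ω, -, rfl⟩ := hH'
    exact hdom ω
  · let adm : WeightedGraph V → Finset (Finset V) := fun H' => Finset.univ.filter fun S =>
      B ⊆ S ∧ ∀ x y, x ∉ S → y ∉ S → (H'.removeVerts B).dist x y ≤ t * d x y
    have hadm : ∀ H', ∃ S ∈ adm H', ∀ S' ∈ adm H', S.card ≤ S'.card := fun H' =>
      (adm H').exists_min_image Finset.card ⟨Finset.univ, by simp [adm]⟩
    choose Bp hBp hmin using hadm
    refine ⟨Bp, fun H' _ => (Finset.mem_filter.1 (hBp H')).2, ?_⟩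
    have hmap : ∑' H', (Q.map H) H' * ((Bp H').card : ℝ≥0∞) =
        ∑ ω, Q ω * ((Bp (H ω)).card : ℝ≥0∞) := by
      simp only [PMF.map_apply, ← ENNReal.tsum_mul_right]
      rw [ENNReal.tsum_comm, tsum_fintype]
      refine Finset.sum_congr rfl fun ω _ => ?_
      rw [tsum_eq_single (H ω) fun H' hH' => by rw [if_neg hH', zero_mul], if_pos rfl]
    rw [hmap]
    refine le_trans (Finset.sum_le_sum fun ω _ => ?_) (hexp B)
    refine mul_le_mul_right (Nat.cast_le.2 (hmin _ _ ?_)) _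
    exact Finset.mem_filter.2 ⟨Finset.mem_univ _, hE B ω, hstretch B ω⟩

/-- Each vertex lies in at most `q * m` clusters, so the loss over all clusters and the number of
edges both carry a factor `q * m`; the former enters the sampling rate `s`. -/
theorem HasBalancedSeparators.exists_spanner {G : WeightedGraph V} {q m : ℕ} (hq : 1 ≤ q)
    (hm : 1 ≤ m) (hV : Fintype.card V < 2 ^ m) (hV1 : 1 ≤ Fintype.card V)
    (hG : G.HasBalancedSeparators q) {ν : ℝ≥0} (hν : 0 < ν) (hν1 : ν < 1) :
    ∃ D : PMF (WeightedGraph V), IsObliviousReliableSpanner G.dist ν 2 D ∧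
      HasAtMostEdges D (8 * (Fintype.card V : ℝ) * (ν : ℝ)⁻¹ * ((q * m : ℕ) : ℝ) ^ 2 *
        (1 + Real.log (Fintype.card V))) := by
  classical
  obtain ⟨F, -, hτ, hF⟩ := hG.exists_clusters m Finset.univ (by simpa using hV)
  replace hF : ∀ x y, G.dist x y ≠ ∞ →
      ∃ p ∈ F, x ∈ p.1 ∧ y ∈ p.1 ∧ G.dist x p.2 + G.dist p.2 y ≤ G.dist x y := fun x y =>
    exists_cluster_dist_add_dist_le F fun x y w => hF x y w fun z _ => Finset.mem_univ z
  choose r hinj himg hmono using fun p : Finset V × V => exists_rank (G.dist p.2) p.1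
  set τ := q * m with hτdef
  have hτ1 : (1 : ℝ) ≤ τ := by exact_mod_cast Nat.mul_pos hq hm
  have hνR : (0 : ℝ) < ν := hν
  have hνR1 : (ν : ℝ) < 1 := hν1
  have hlog : (0 : ℝ) ≤ Real.log (Fintype.card V) := Real.log_natCast_nonneg _
  have hVR : (1 : ℝ) ≤ Fintype.card V := by exact_mod_cast hV1
  -- `s` makes the conditional expected loss `2 * (τ * |B| / (s - 1))` at most `ν * |B|`
  obtain ⟨s, hs2, hs, hs'⟩ : ∃ s : ℕ, 2 ≤ s ∧ 2 * τ / (ν : ℝ) ≤ s - 1 ∧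
      (s : ℝ) ≤ 4 * τ / ν := by
    have h1 : 1 ≤ 2 * τ / (ν : ℝ) / 2 := by
      rw [le_div_iff₀ two_pos, le_div_iff₀ hνR]
      nlinarith
    refine ⟨⌈2 * τ / (ν : ℝ)⌉₊ + 1, ?_, ?_, ?_⟩
    · have : 0 < ⌈2 * τ / (ν : ℝ)⌉₊ := Nat.ceil_pos.2 (by positivity)
      omega
    · push_cast
      linarith [Nat.le_ceil (2 * τ / (ν : ℝ))]
    · have h2 := Nat.ceil_lt_add_one (show 0 ≤ 2 * τ / (ν : ℝ) by positivity)
      have h3 : 4 * τ / (ν : ℝ) = 2 * τ / ν + 2 * τ / ν := by ring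
      push_cast
      linarith
  have hs1 : (0 : ℝ) < s - 1 := by
    have : (2 : ℝ) ≤ s := by exact_mod_cast hs2
    linarith
  have hM := sum_card_sampled_mul_card_le (s := s) hτ (fun p _ => hinj p) fun p _ => himg p
  obtain ⟨Q, hQX, hQY⟩ := exists_pmf_le_two_mul_mean (bernoulliWeight (clusterProb s r)) _
    (bernoulliWeight_nonneg (fun a => sampleProb_nonneg s _) fun a => sampleProb_le_one s _)
    (sum_bernoulliWeight _) (fun ω => Nat.cast_nonneg _) (by positivity) hM
  refine ⟨Q.map (G.sampledSpanner F r), exists_isObliviousReliableSpanner_map G.dist ν 2 Q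
    (G.sampledSpanner F r) sampledSpanner_dominates
    (fun B ω => B ∪ F.biUnion (lostVertices r ω B)) (fun B ω => Finset.subset_union_left)
    (fun B ω x y hx hy => dist_sampledSpanner_removeVerts_le_two_mul hF (fun p _ => hmono p)
      ω B hx hy) fun B => ?_, fun H hH => ?_⟩
  · have hcard : ∀ ω, ((B ∪ F.biUnion (lostVertices r ω B)).card : ℝ≥0∞) ≤
        B.card + ((∑ p ∈ F, (lostVertices r ω B p).card : ℕ) : ℝ≥0∞) := fun ω => by
      exact_mod_cast (Finset.card_union_le _ _).trans
        (Nat.add_le_add_left Finset.card_biUnion_le _)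
    have hlost := sum_card_lostVertices_le (r := r) hs2 hτ (fun p _ => hinj p)
      (fun p _ => himg p) B
    have hν2 : 2 * (τ * B.card / (s - 1 : ℝ)) ≤ ν * B.card := by
      rw [div_le_iff₀ hνR] at hs
      rw [← mul_div_assoc, div_le_iff₀ hs1]
      nlinarith [mul_le_mul_of_nonneg_right hs (Nat.cast_nonneg (α := ℝ) B.card)]
    calc ∑ ω, Q ω * ((B ∪ F.biUnion (lostVertices r ω B)).card : ℝ≥0∞)
        ≤ ∑ ω, (Q ω * B.card +
            Q ω * ((∑ p ∈ F, (lostVertices r ω B p).card : ℕ) : ℝ≥0∞)) :=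
          Finset.sum_le_sum fun ω _ => by
            rw [← mul_add]
            exact mul_le_mul_right (hcard ω) _
      _ = B.card + ∑ ω, Q ω * ((∑ p ∈ F, (lostVertices r ω B p).card : ℕ) : ℝ≥0∞) := by
          rw [Finset.sum_add_distrib, ← Finset.sum_mul, ← tsum_fintype (L := .unconditional _),
            PMF.tsum_coe, one_mul]
      _ ≤ B.card + ENNReal.ofReal (ν * B.card) := by
          refine add_le_add_right ((hQY _).trans (ENNReal.ofReal_le_ofReal ?_)) _
          linarith
      _ = (1 + ν) * B.card := by
          rw [ENNReal.ofReal_mul hνR.le, ENNReal.ofReal_natCast, ENNReal.ofReal_coe_nnreal]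
          ring
  · rw [PMF.support_map] at hH
    obtain ⟨ω, hω, rfl⟩ := hH
    have h1 : ((G.sampledSpanner F r ω).numEdges : ℝ) ≤ _ :=
      Nat.cast_le.2 (numEdges_sampledSpanner_le ω)
    refine (h1.trans (hQX ω hω)).trans ?_
    have h2 : 2 * ((Fintype.card V : ℝ) * τ * (s * (1 + Real.log (Fintype.card V)))) ≤
        2 * ((Fintype.card V : ℝ) * τ * (4 * τ / ν * (1 + Real.log (Fintype.card V)))) := by
      gcongr
    refine h2.trans (le_of_eq ?_)
    field_simp
    ring

/-- The bound in terms of `log n` alone, for `n ≥ 2` vertices: here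
`m = ⌊log₂ n⌋ + 1 ≤ 3 log n` and `1 + log n ≤ 3 log n`. -/
theorem HasBalancedSeparators.exists_spanner_log {G : WeightedGraph V} {q : ℕ} (hq : 1 ≤ q)
    (hV : 2 ≤ Fintype.card V) (hG : G.HasBalancedSeparators q) {ν : ℝ≥0} (hν : 0 < ν)
    (hν1 : ν < 1) :
    ∃ D : PMF (WeightedGraph V), IsObliviousReliableSpanner G.dist ν 2 D ∧
      HasAtMostEdges D (216 * (Fintype.card V : ℝ) * (ν : ℝ)⁻¹ * (q : ℝ) ^ 2 *
        Real.log (Fintype.card V) ^ 3) := by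
  obtain ⟨D, hD, hDe⟩ := hG.exists_spanner hq (Nat.le_add_left 1 (Nat.log 2 (Fintype.card V)))
    (Nat.lt_pow_succ_log_self one_lt_two _) (by omega) hν hν1
  refine ⟨D, hD, fun H hH => (hDe H hH).trans ?_⟩
  have hl2 : Real.log 2 ≤ Real.log (Fintype.card V) :=
    Real.log_le_log two_pos (by exact_mod_cast hV)
  have hl := Real.log_two_gt_d9
  have hl0 : 0 < Real.log (Fintype.card V) := by linarith
  have hm : ((Nat.log 2 (Fintype.card V) + 1 : ℕ) : ℝ) ≤ 3 * Real.log (Fintype.card V) := by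
    have h1 : (Nat.log 2 (Fintype.card V) : ℝ) * Real.log 2 ≤ Real.log (Fintype.card V) := by
      rw [← Real.log_pow]
      refine Real.log_le_log (by positivity) ?_
      have h2 : Fintype.card V ≠ 0 := by omega
      exact_mod_cast Nat.pow_log_le_self 2 h2
    push_cast
    nlinarith
  set n : ℝ := (Fintype.card V : ℝ)
  set ℓ := Real.log n
  have h1 : 1 + ℓ ≤ 3 * ℓ := by linarith
  calc 8 * n * (ν : ℝ)⁻¹ * ((q * (Nat.log 2 (Fintype.card V) + 1) : ℕ) : ℝ) ^ 2 * (1 + ℓ)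
      ≤ 8 * n * (ν : ℝ)⁻¹ * (q * (3 * ℓ)) ^ 2 * (3 * ℓ) := by
        rw [Nat.cast_mul]
        gcongr
    _ = 216 * n * (ν : ℝ)⁻¹ * (q : ℝ) ^ 2 * ℓ ^ 3 := by ring

end WeightedGraph

/-! ### Optimality of the stretch -/

/-- The star with all edge weights equal to one. -/
def unitStar {V : Type*} (c : V) : WeightedGraph V := ⟨SimpleGraph.starGraph c, fun _ => 1⟩

theorem two_le_dist_unitStar {V : Type*} {c x y : V} (hx : x ≠ c) (hy : y ≠ c) (hxy : x ≠ y) :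
    2 ≤ (unitStar c).dist x y := by
  refine le_iInf fun p => ?_
  cases p with
  | nil => exact absurd rfl hxy
  | cons h q =>
    cases q with
    | nil =>
      rcases (SimpleGraph.starGraph_adj.1 h).2 with h | h
      · exact absurd h hx
      · exact absurd h hy
    | cons h' q =>
      rw [walkWeight_cons, walkWeight_cons, ← add_assoc, ENNReal.coe_add, ENNReal.coe_add]
      change (2 : ℝ≥0∞) ≤ (1 : ℝ≥0) + (1 : ℝ≥0) + _
      rw [ENNReal.coe_one, one_add_one_eq_two]
      exact le_self_add

theorem dist_unitStar_le_two {V : Type*} (c x y : V) : (unitStar c).dist x y ≤ 2 := by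
  have h : ∀ z, (unitStar c).dist c z ≤ 1 := fun z => by
    rcases eq_or_ne c z with rfl | hz
    · simp
    · exact (unitStar c).dist_le_weight (SimpleGraph.starGraph_center_adj hz)
  refine ((unitStar c).dist_triangle x c y).trans ?_
  rw [dist_comm, ← one_add_one_eq_two]
  exact add_le_add (h x) (h y)

/-- If `H` dominates the star metric, then leaves at distance less than `4` after the failure of
the centre are adjacent: every other walk between them has two edges, each of length at least
`2`. -/
theorem adj_of_dist_removeVerts_lt_four {V : Type*} {c x y : V} {H : WeightedGraph V}
    (hH : H.Dominates (unitStar c).dist) (hxy : x ≠ y)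
    (h : (H.removeVerts {c}).dist x y < 4) : H.graph.Adj x y := by
  obtain ⟨p, hp⟩ := iInf_lt_iff.1 h
  have hw : ∀ {a b : V}, (H.removeVerts {c}).graph.Adj a b → 2 ≤ H.weight s(a, b) :=
    fun {a b} hab => by
      have h1 := (two_le_dist_unitStar (by simpa using hab.2.1) (by simpa using hab.2.2)
        hab.1.ne).trans ((hH a b).trans (H.dist_le_weight hab.1))
      exact_mod_cast h1
  cases p with
  | nil => exact absurd rfl hxy
  | cons hab q =>
    cases q with
    | nil => exact hab.1
    | cons hbc q =>
      exfalso
      rw [walkWeight_cons, walkWeight_cons, ← add_assoc] at hp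
      have h4 : (4 : ℝ≥0) ≤ H.weight s(_, _) + H.weight s(_, _) :=
        le_trans (by norm_num) (add_le_add (hw hab) (hw hbc))
      exact hp.not_ge (by exact_mod_cast h4.trans le_self_add)

/-- Since fewer than two vertices fail in expectation when only `c` is attacked, some graph of the
distribution has no further faulty vertices. -/
theorem IsObliviousReliableSpanner.exists_forall_ne {V : Type*} {d : V → V → ℝ≥0∞}
    {ν t : ℝ≥0} {D : PMF (WeightedGraph V)} (hD : IsObliviousReliableSpanner d ν t D) (hν : ν < 1)
    (c : V) : ∃ H ∈ D.support, ∀ x y, x ≠ c → y ≠ c → (H.removeVerts {c}).dist x y ≤ t * d x y := by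
  obtain ⟨Bp, hBp, hE⟩ := hD.2 {c}
  by_contra! hno
  have h2 : ∀ H, D H * 2 ≤ D H * ((Bp H).card : ℝ≥0∞) := fun H => by
    by_cases hH : H ∈ D.support
    · refine mul_le_mul_right ?_ _
      obtain ⟨hsub, hst⟩ := hBp H hH
      have hlt : 1 < (Bp H).card := by
        by_contra! hle
        have heq := Finset.eq_of_subset_of_card_le hsub (by simpa using hle)
        obtain ⟨x, y, hx, hy, hlt⟩ := hno H hH
        exact hlt.not_ge (hst x y (by simpa [← heq] using hx) (by simpa [← heq] using hy))
      exact_mod_cast hlt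
    · rw [PMF.mem_support_iff, not_not] at hH
      simp [hH]
  have h3 := (ENNReal.tsum_le_tsum h2).trans hE
  rw [ENNReal.tsum_mul_right, PMF.tsum_coe, one_mul, Finset.card_singleton, Nat.cast_one,
    mul_one] at h3
  have h4 : (2 : ℝ≥0) ≤ 1 + ν := by exact_mod_cast h3
  rw [← one_add_one_eq_two, add_le_add_iff_left] at h4
  exact h4.not_gt hν

/-- Without an attack no vertex is faulty. -/
theorem IsObliviousReliableSpanner.dist_le_of_mem_support {V : Type*} {d : V → V → ℝ≥0∞}
    {ν t : ℝ≥0} {D : PMF (WeightedGraph V)} (hD : IsObliviousReliableSpanner d ν t D)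
    {H : WeightedGraph V} (hH : H ∈ D.support) (x y : V) :
    (H.removeVerts ∅).dist x y ≤ t * d x y := by
  obtain ⟨Bp, hBp, hE⟩ := hD.2 ∅
  rw [Finset.card_empty, Nat.cast_zero, mul_zero, nonpos_iff_eq_zero, ENNReal.tsum_eq_zero] at hE
  have h0 : Bp H = ∅ := by
    rcases mul_eq_zero.1 (hE H) with h | h
    · exact absurd h ((PMF.mem_support_iff _ _).1 hH)
    · simpa using h
  exact (hBp H hH).2 x y (by simp [h0]) (by simp [h0])

/-- A graph that contains all edges between the `n - 1` vertices other than `c` has at least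
`(n - 1).choose 2` edges. -/
theorem choose_two_le_numEdges {V : Type*} [Fintype V] {c : V} {H : WeightedGraph V}
    (h : ∀ x y, x ≠ c → y ≠ c → x ≠ y → H.graph.Adj x y) :
    (Fintype.card V - 1).choose 2 ≤ H.numEdges := by
  classical
  have hcard : (Finset.univ.erase c).card = Fintype.card V - 1 := by
    rw [Finset.card_erase_of_mem (Finset.mem_univ c), Finset.card_univ]
  rw [← hcard, ← Sym2.card_image_offDiag, ← Set.ncard_coe_finset]
  refine Set.ncard_le_ncard (fun e he => ?_) (Set.toFinite _)
  obtain ⟨⟨x, y⟩, hxy, rfl⟩ := Finset.mem_image.1 (Finset.mem_coe.1 he)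
  obtain ⟨hx, hy, hne⟩ := Finset.mem_offDiag.1 hxy
  exact h x y (Finset.ne_of_mem_erase hx) (Finset.ne_of_mem_erase hy) hne

/-- Attacking the centre of the star forces all edges between leaves. For `n = 2` there are none,
but the spanner needs an edge in order to be connected. -/
theorem sq_le_of_isObliviousReliableSpanner_unitStar {n : ℕ} (hn : 2 ≤ n) (c : Fin n) {ν t : ℝ≥0}
    (hν : ν < 1) (ht : t < 2) {D : PMF (WeightedGraph (Fin n))} {m : ℝ}
    (hD : IsObliviousReliableSpanner (unitStar c).dist ν t D) (hm : HasAtMostEdges D m) :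
    1 / 9 * (n : ℝ) ^ 2 ≤ m := by
  rcases hn.eq_or_lt with rfl | hn3
  · obtain ⟨H, hH⟩ := D.support_nonempty
    refine le_trans ?_ (hm H hH)
    have hlt : (H.removeVerts ∅).dist 0 1 ≠ ∞ := by
      refine ne_top_of_le_ne_top ?_ (hD.dist_le_of_mem_support hH 0 1)
      exact ENNReal.mul_ne_top ENNReal.coe_ne_top
        (ne_top_of_le_ne_top (by simp) (dist_unitStar_le_two c 0 1))
    obtain ⟨p⟩ := nonempty_walk_of_dist_ne_top _ hlt
    have hpos : 0 < H.numEdges := by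
      cases p with
      | cons h q => exact (Set.ncard_pos (Set.toFinite _)).2 ⟨_, SimpleGraph.mem_edgeSet _ |>.2 h.1⟩
    have : (1 : ℝ) ≤ H.numEdges := by exact_mod_cast hpos
    push_cast
    linarith
  · obtain ⟨H, hH, hst⟩ := hD.exists_forall_ne hν c
    refine le_trans ?_ (hm H hH)
    have hedges := choose_two_le_numEdges (c := c) (H := H) fun x y hx hy hxy => by
      refine adj_of_dist_removeVerts_lt_four (hD.1 H hH) hxy ((hst x y hx hy).trans_lt ?_)
      refine (mul_le_mul_right (dist_unitStar_le_two c x y) _).trans_lt ?_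
      have h4 : t * 2 < 4 := lt_of_lt_of_eq (mul_lt_mul_of_pos_right ht two_pos) (by norm_num)
      exact_mod_cast h4
    rw [Fintype.card_fin] at hedges
    have h1 : (((n - 1).choose 2 : ℕ) : ℝ) ≤ H.numEdges := by exact_mod_cast hedges
    rw [Nat.cast_choose_two, Nat.cast_sub (by omega)] at h1
    have h3 : (3 : ℝ) ≤ n := by exact_mod_cast hn3
    push_cast at h1
    nlinarith

/-! ### The bounds for bounded treewidth and trees, and their optimality -/

theorem mainTheorem1 :
    -- graphs of treewidth at most `k`
    (∃ C : ℝ, 0 < C ∧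
      ∀ (V : Type*) [Fintype V] (G : WeightedGraph V) (k : ℕ), HasTreewidthAtMost G.graph k →
        ∀ ν : ℝ≥0, 0 < ν → ν < 1 →
          ∃ D : PMF (WeightedGraph V), IsObliviousReliableSpanner G.dist ν 2 D ∧
            HasAtMostEdges D
              (C * (Fintype.card V : ℝ) * (ν : ℝ)⁻¹ * (k : ℝ) ^ 2 *
                Real.log (Fintype.card V) ^ 3)) ∧
    -- trees
    (∃ C : ℝ, 0 < C ∧
      ∀ (V : Type*) [Fintype V] (G : WeightedGraph V), G.graph.IsTree →
        ∀ ν : ℝ≥0, 0 < ν → ν < 1 →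
          ∃ D : PMF (WeightedGraph V), IsObliviousReliableSpanner G.dist ν 2 D ∧
            HasAtMostEdges D
              (C * (Fintype.card V : ℝ) * (ν : ℝ)⁻¹ * Real.log (Fintype.card V) ^ 3)) ∧
    -- stretch two is optimal, already for unweighted trees
    (∃ c : ℝ, 0 < c ∧
      ∀ ν : ℝ≥0, 0 < ν → ν < 1 → ∀ n : ℕ, 2 ≤ n →
        ∃ T : WeightedGraph (Fin n), T.graph.IsTree ∧ T.IsUnweighted ∧
          ∀ t : ℝ≥0, t < 2 → ∀ (D : PMF (WeightedGraph (Fin n))) (m : ℝ),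
            IsObliviousReliableSpanner T.dist ν t D → HasAtMostEdges D m →
              c * (n : ℝ) ^ 2 ≤ m) := by
  refine ⟨⟨864, by norm_num, ?_⟩, ⟨216, by norm_num, ?_⟩, ⟨1 / 9, by norm_num, ?_⟩⟩
  · intro V _ G k hk ν hν hν1
    classical
    have hlog : 0 ≤ Real.log (Fintype.card V) := Real.log_natCast_nonneg _
    by_cases hbot : G.graph = ⊥
    · obtain ⟨D, hD, hDe⟩ := exists_spanner_of_graph_eq_bot G hbot ν 2 two_ne_zero
      exact ⟨D, hD, fun H hH => (hDe H hH).trans (by positivity)⟩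
    · obtain ⟨x, y, hxy⟩ := SimpleGraph.ne_bot_iff_exists_adj.1 hbot
      have hV : 2 ≤ Fintype.card V := Fintype.one_lt_card_iff.2 ⟨x, y, hxy.ne⟩
      -- a bag that contains an edge has at least two vertices
      have hk1 : 1 ≤ k := by
        obtain ⟨T, hT⟩ := hk
        obtain ⟨i, hx, hy⟩ := T.edge_mem x y hxy
        have := Finset.one_lt_card.2 ⟨x, hx, y, hy, hxy.ne⟩
        have := hT i
        omega
      obtain ⟨D, hD, hDe⟩ := (G.hasBalancedSeparators_of_hasTreewidthAtMost hk).exists_spanner_log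
        (by omega) hV hν hν1
      refine ⟨D, hD, fun H hH => (hDe H hH).trans ?_⟩
      have hkR : ((k + 1 : ℕ) : ℝ) ≤ 2 * k := by exact_mod_cast (by omega : k + 1 ≤ 2 * k)
      calc 216 * (Fintype.card V : ℝ) * (ν : ℝ)⁻¹ * ((k + 1 : ℕ) : ℝ) ^ 2 *
            Real.log (Fintype.card V) ^ 3
          ≤ 216 * (Fintype.card V : ℝ) * (ν : ℝ)⁻¹ * (2 * k) ^ 2 *
            Real.log (Fintype.card V) ^ 3 := by gcongr
        _ = _ := by ring
  · intro V _ G hG ν hν hν1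
    classical
    have hlog : 0 ≤ Real.log (Fintype.card V) := Real.log_natCast_nonneg _
    by_cases hbot : G.graph = ⊥
    · obtain ⟨D, hD, hDe⟩ := exists_spanner_of_graph_eq_bot G hbot ν 2 two_ne_zero
      exact ⟨D, hD, fun H hH => (hDe H hH).trans (by positivity)⟩
    · obtain ⟨x, y, hxy⟩ := SimpleGraph.ne_bot_iff_exists_adj.1 hbot
      have hV : 2 ≤ Fintype.card V := Fintype.one_lt_card_iff.2 ⟨x, y, hxy.ne⟩
      obtain ⟨D, hD, hDe⟩ := (G.hasBalancedSeparators_of_isTree hG).exists_spanner_log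
        le_rfl hV hν hν1
      exact ⟨D, hD, fun H hH => (hDe H hH).trans (by simp)⟩
  · intro ν _ hν1 n hn
    exact ⟨unitStar ⟨0, by omega⟩, SimpleGraph.isTree_starGraph _, fun _ _ => rfl,
      fun t ht D m hD hm => sq_le_of_isObliviousReliableSpanner_unitStar hn _ hν1 ht hD hm⟩
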